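/- Let $\mathbf{L}$ and $\mathbf{H}$ be real Hilbert spaces, let $\mathbf{X}$ be a set, let $\mathbf{Y}\subset\mathbf{L}$ be non-empty with compact closure, and let $\mathbf{F}=\overline{\mathrm{co}}\,\mathbf{Y}$ be the closed convex hull of $\mathbf{Y}$. Let $\Phi:\mathbf{F}\times\mathbf{X}\to\mathbf{H}$ and let $\mathbf{K}((f,x),(f',x'))=\langle\Phi(f,x),\Phi(f',x')\rangle_{\mathbf{H}}$ be its kernel. Assume that $\mathbf{K}$ is admissible: $\mathbf{K}((f,x),(f',x'))$ is continuous in $f\in\mathbf{F}$ for all fixed $x,f',x'$. In each round $n=1,2,\dots$ of the forecasting game, Reality announces $x_n\in\mathbf{X}$, then Forecaster announces $f_n\in\mathbf{F}$, then Reality announces $y_n\in\mathbf{Y}$; all moves are seen by both players. A K29 strategy (with parameter $\mathbf{K}$) is a strategy for Forecaster, that is, a function assigning a forecast $f_n$ to any moves of the previous rounds and any current datum $x_n$, such that, for $$S(f)=\sum_{i=1}^{n-1}\mathbf{K}((f_i,x_i),(f,x_n))\,(y_i-f_i),\qquad f\in\mathbf{F},$$ the forecast satisfies $S(f_n)=0$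 or, if $S$ has no zero in $\mathbf{F}$, $f_n$ is a point of the boundary $\partial\mathbf{F}$ at which $S$ is normal and directed exteriorly to $\mathbf{F}$, i.e. $\langle S(f_n),g-f_n\rangle_{\mathbf{L}}\le 0$ for all $g\in\mathbf{F}$. Then a K29 strategy exists. If, moreover, $C_\Phi:=\sup_{(f,x)\in\mathbf{F}\times\mathbf{X}}\|\Phi(f,x)\|_{\mathbf{H}}<\infty$, then every K29 strategy guarantees that, for all moves of Reality and for all $n$, $$\left\|\sum_{i=1}^n (y_i-f_i)\otimes\Phi(f_i,x_i)\right\|_{\mathbf{L}\otimes\mathbf{H}}\le \operatorname{diam}(\mathbf{Y})\,C_\Phi\sqrt{n},$$ where $\mathbf{L}\otimes\mathbf{H}$ is the Hilbert-space tensor product and $\operatorname{diam}(\mathbf{Y})=\sup_{y,y'\in\mathbf{Y}}\|y-y'\|_{\mathbf{L}}$. -/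

import Mathlib

open scoped TensorProduct

namespace K29

noncomputable section

/-- The Hilbert-space tensor product: the completion of the algebraic tensor product with respect
to the inner product determined by `⟪l₁ ⊗ h₁, l₂ ⊗ h₂⟫ = ⟪l₁, l₂⟫ * ⟪h₁, h₂⟫`. -/
abbrev HilbertTensor (L H : Type*) [NormedAddCommGroup L] [InnerProductSpace ℝ L]
    [NormedAddCommGroup H] [InnerProductSpace ℝ H] : Type _ :=
  UniformSpace.Completion (L ⊗[ℝ] H)

/-- The elementary tensor `l ⊗ h` as an element of the Hilbert-space tensor product. -/
def tmul {L H : Type*} [NormedAddCommGroup L] [InnerProductSpace ℝ L]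
    [NormedAddCommGroup H] [InnerProductSpace ℝ H] (l : L) (h : H) : HilbertTensor L H :=
  ((l ⊗ₜ[ℝ] h : L ⊗[ℝ] H) : UniformSpace.Completion (L ⊗[ℝ] H))

/-- Forecaster's move space: the closed convex hull of the observation space `Y`. -/
abbrev Forecasts {L : Type*} [NormedAddCommGroup L] [InnerProductSpace ℝ L] (Y : Set L) : Set L :=
  closedConvexHull ℝ Y

/-- The moves made in one round of the game: datum, forecast, observation. -/
structure Round (X : Type*) {L : Type*} [NormedAddCommGroup L] [InnerProductSpace ℝ L]
    (Y : Set L) where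
  /-- the datum announced by Reality -/
  datum : X
  /-- the forecast announced by Forecaster -/
  forecast : Forecasts Y
  /-- the observation announced by Reality -/
  obs : Y

/-- A strategy for Forecaster: given the moves of all the previous rounds (in chronological order)
and the datum of the current round, it outputs a forecast. -/
abbrev Strategy (X : Type*) {L : Type*} [NormedAddCommGroup L] [InnerProductSpace ℝ L]
    (Y : Set L) : Type _ :=
  List (Round X Y) → X → Forecasts Y

section Game

variable {X L : Type*} [NormedAddCommGroup L] [InnerProductSpace ℝ L] {Y : Set L}

/-- The first `n` rounds of the game in which Forecaster follows `σ` and Reality announces the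
data `x 0, x 1, …` and the observations `y 0, y 1, …`. -/
def history (σ : Strategy X Y) (x : ℕ → X) (y : ℕ → Y) : ℕ → List (Round X Y)
  | 0 => []
  | n + 1 => history σ x y n ++ [⟨x n, σ (history σ x y n) (x n), y n⟩]

/-- The forecast announced in the round with index `n` (rounds are indexed from `0`) of that
game. -/
def forecastAt (σ : Strategy X Y) (x : ℕ → X) (y : ℕ → Y) (n : ℕ) : Forecasts Y :=
  σ (history σ x y n) (x n)

/-- The kernel `⟪Φ(f, x), Φ(f', x')⟫` of a feature mapping `Φ`. -/
def kernel {H : Type*} [NormedAddCommGroup H] [InnerProductSpace ℝ H]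
    (Φ : Forecasts Y × X → H) (z z' : Forecasts Y × X) : ℝ :=
  inner ℝ (Φ z) (Φ z')

/-- A kernel `K((f, x), (f', x'))` is admissible if it is continuous in `f`. -/
def Admissible (K : Forecasts Y × X → Forecasts Y × X → ℝ) : Prop :=
  ∀ (x : X) (z' : Forecasts Y × X), Continuous fun f : Forecasts Y => K (f, x) z'

/-- The vector field `S(f) = ∑ᵢ K((fᵢ, xᵢ), (f, x)) (yᵢ - fᵢ)`, where `i` ranges over the past
rounds and `x` is the current datum. -/
def field (K : Forecasts Y × X → Forecasts Y × X → ℝ) (past : List (Round X Y)) (x : X)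
    (f : Forecasts Y) : L :=
  (past.map fun r => K (r.forecast, r.datum) (f, x) • ((r.obs : L) - (r.forecast : L))).sum

/-- The vector field `S` on `Forecasts Y` is, at the point `f`, normal and directed exteriorly to
`Forecasts Y`. -/
def ExteriorNormalAt (S : Forecasts Y → L) (f : Forecasts Y) : Prop :=
  ∀ g : Forecasts Y, inner ℝ (S f) ((g : L) - (f : L)) ≤ 0

/-- `f` is a choice allowed by the K29 rule for the vector field `S`: a zero of `S` or, if `S` has
no zero, a boundary point at which `S` is normal and directed exteriorly. -/
def IsK29Choice (S : Forecasts Y → L) (f : Forecasts Y) : Prop :=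
  S f = 0 ∨
    ((¬ ∃ g : Forecasts Y, S g = 0) ∧ (f : L) ∈ frontier (Forecasts Y) ∧ ExteriorNormalAt S f)

/-- `σ` is a K29 strategy with parameter `K`. -/
def IsK29 (K : Forecasts Y × X → Forecasts Y × X → ℝ) (σ : Strategy X Y) : Prop :=
  ∀ (past : List (Round X Y)) (x : X), IsK29Choice (field K past x) (σ past x)

end Game

end

end K29

/-!
Existence of a K29 strategy amounts to a variational inequality: a continuous vector field `S` on
the compact convex set `Forecasts Y` has a point `f` with `⟪S f, g - f⟫ ≤ 0` for all `g`
(`exists_inner_le_of_isCompact`). If `S f ≠ 0` at such a point, then `f` has a nonzero exterior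
normal, so it lies on the frontier (`mem_frontier_of_inner_le`). By compactness it suffices to test
finitely many `g`, so one may replace the set by a polytope in a finite-dimensional space; there a
solution is a fixed point of `x ↦ π (x + S x)`, with `π` the metric projection, which exists by
Brouwer's theorem (`exists_fixedPoint_of_bounded`).

Brouwer's theorem is obtained by smooth approximation from the absence of a `C¹` retraction of a
ball onto its sphere, proved by the volume argument of Milnor and Rogers. If `r` is `C¹` up to the
boundary and fixes the sphere, then with `g = r - id` the map `id + t g` is, for small `t ≥ 0`, a
bijection of the ball with positive Jacobian, so `∫ det (1 + t Dg)` is the volume of the ball. This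
integral is polynomial in `t`, hence it is the volume at `t = 1` as well
(`integral_det_fderiv_ball`). But the Jacobian of a retraction onto the sphere is zero.

For the bound, the K29 rule gives `⟪S fₙ, yₙ - fₙ⟫ ≤ 0`, both for zeros and for exterior normals.
The left-hand side is the inner product of the cumulative error `∑ (yᵢ - fᵢ) ⊗ Φ(fᵢ, xᵢ)` with its
next term (`inner_sum_tmul_le`), so the squared norm grows by at most `(diam Y * sup ‖Φ‖)²` per
round.
-/

namespace K29

open Set Filter Topology MeasureTheory Metric

/-! ### The metric projection onto a closed convex set -/

/-- The metric projection onto a complete convex set: it is `1`-Lipschitz, and is characterised by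
the obtuse angle criterion. -/
theorem exists_metricProjection {E : Type*} [NormedAddCommGroup E] [InnerProductSpace ℝ E]
    {C : Set E} (hne : C.Nonempty) (hC : IsComplete C) (hconv : Convex ℝ C) :
    ∃ π : E → E, LipschitzWith 1 π ∧ (∀ x, π x ∈ C) ∧ (∀ x ∈ C, π x = x) ∧
      ∀ x, ∀ w ∈ C, inner ℝ (x - π x) (w - π x) ≤ 0 := by
  choose π hπC hπ using exists_norm_eq_iInf_of_complete_convex hne hC hconv
  have key : ∀ x, ∀ w ∈ C, inner ℝ (x - π x) (w - π x) ≤ 0 := fun x =>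
    (norm_eq_iInf_iff_real_inner_le_zero hconv (hπC x)).1 (hπ x)
  refine ⟨π, ?_, hπC, ?_, key⟩
  · refine LipschitzWith.of_dist_le_mul fun x y => ?_
    rw [NNReal.coe_one, one_mul, dist_eq_norm, dist_eq_norm]
    have h1 := key x (π y) (hπC y)
    have h2 := key y (π x) (hπC x)
    -- Adding the two obtuse angle inequalities gives `‖π x - π y‖² ≤ ⟪x - y, π x - π y⟫`.
    have h3 : ‖π x - π y‖ * ‖π x - π y‖ ≤ inner ℝ (x - y) (π x - π y) := by
      rw [← real_inner_self_eq_norm_mul_norm]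
      simp only [inner_sub_left, inner_sub_right] at h1 h2 ⊢
      linarith [real_inner_comm (π x) (π y)]
    have h4 := real_inner_le_norm (x - y) (π x - π y)
    by_contra! hlt
    nlinarith [norm_nonneg (x - y)]
  · intro x hx
    have h := key x x hx
    rw [real_inner_self_eq_norm_mul_norm] at h
    have : ‖x - π x‖ = 0 := by nlinarith [norm_nonneg (x - π x)]
    exact (sub_eq_zero.1 (norm_eq_zero.1 this)).symm

/-- A point at which a set has a nonzero exterior normal is a boundary point. -/
theorem mem_frontier_of_inner_le {E : Type*} [NormedAddCommGroup E] [InnerProductSpace ℝ E]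
    {C : Set E} {f v : E} (hf : f ∈ C) (hv : v ≠ 0)
    (h : ∀ g ∈ C, inner ℝ v (g - f) ≤ 0) : f ∈ frontier C := by
  refine ⟨subset_closure hf, fun hint => ?_⟩
  have hc : Tendsto (fun t : ℝ => f + t • v) (𝓝[>] 0) (𝓝 f) := by
    have : Continuous fun t : ℝ => f + t • v := by fun_prop
    simpa using (this.tendsto 0).mono_left nhdsWithin_le_nhds
  obtain ⟨t, ht, ht0⟩ :=
    ((hc.eventually (mem_interior_iff_mem_nhds.1 hint)).and self_mem_nhdsWithin).exists
  have := h _ ht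
  rw [add_sub_cancel_left, real_inner_smul_right, real_inner_self_eq_norm_mul_norm] at this
  have hv' := norm_pos_iff.2 hv
  have ht0' : (0 : ℝ) < t := ht0
  have : 0 < t * (‖v‖ * ‖v‖) := by positivity
  linarith

/-! ### There is no smooth retraction of a ball onto its sphere -/

/-- As `t ↦ det (1 + t A)` is a polynomial of degree at most the dimension, its value at `1` is a
combination of its values at given nodes, with weights that do not depend on `A`. -/
theorem exists_weights_det (E : Type*) [NormedAddCommGroup E] [NormedSpace ℝ E]
    [FiniteDimensional ℝ E] {v : Fin (Module.finrank ℝ E + 1) → ℝ} (hv : Function.Injective v) :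
    ∃ w : Fin (Module.finrank ℝ E + 1) → ℝ, ∑ i, w i = 1 ∧
      ∀ A : E →L[ℝ] E, (1 + A).det = ∑ i, w i * (1 + v i • A).det := by
  refine ⟨fun i => (Lagrange.basis Finset.univ v i).eval 1, ?_, fun A => ?_⟩
  · rw [← Polynomial.eval_finsetSum, Lagrange.sum_basis hv.injOn Finset.univ_nonempty,
      Polynomial.eval_one]
  · let b := Module.finBasis ℝ E
    let M := LinearMap.toMatrix b b (A : E →ₗ[ℝ] E)
    let p : Polynomial ℝ := Matrix.det
      ((Polynomial.X : Polynomial ℝ) • M.map Polynomial.C + (1 : Matrix _ _ ℝ).map Polynomial.C)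
    have hp : ∀ t : ℝ, p.eval t = (1 + t • A).det := by
      intro t
      have h1 : p.eval t = (t • M + 1).det := by
        rw [← Polynomial.coe_evalRingHom, RingHom.map_det]
        congr 1
        ext i j
        rcases eq_or_ne i j with rfl | hij
        · simp [mul_comm t (M i i)]
        · simp [hij, mul_comm t (M i j)]
      rw [h1, ContinuousLinearMap.det, ← LinearMap.det_toMatrix b]
      congr 1
      rw [add_comm]
      simp [M, LinearMap.toMatrix_one, map_add]
    have hdeg : p.degree < (Finset.univ : Finset (Fin (Module.finrank ℝ E + 1))).card := by
      refine lt_of_le_of_lt Polynomial.degree_le_natDegree ?_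
      have := Polynomial.natDegree_det_X_add_C_le M 1
      rw [Fintype.card_fin] at this
      rw [Finset.card_univ, Fintype.card_fin]
      exact_mod_cast Nat.lt_succ_of_le this
    have h := congrArg (Polynomial.eval 1) (Lagrange.eq_interpolate hv.injOn hdeg)
    rw [hp, one_smul, Lagrange.interpolate_apply, Polynomial.eval_finsetSum] at h
    rw [h]
    refine Finset.sum_congr rfl fun i _ => ?_
    rw [Polynomial.eval_mul, Polynomial.eval_C, hp, mul_comm]

/-- A Lipschitz map `G` supported in a ball moves the ball to itself bijectively under `id + t G`,
provided `t G` is a contraction. -/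
theorem bijOn_ball_add_smul {E : Type*} [NormedAddCommGroup E] [NormedSpace ℝ E] [CompleteSpace E]
    {G : E → E} {K : NNReal} (hG : LipschitzWith K G) {R : ℝ} (hR : ∀ x, R ≤ ‖x‖ → G x = 0)
    {t : ℝ} (ht : ‖t‖₊ * K < 1) : BijOn (fun x => x + t • G x) (ball 0 R) (ball 0 R) := by
  have hLip : LipschitzWith (‖t‖₊ * K) fun x => t • G x := (lipschitzWith_smul t).comp hG
  have hinj : Function.Injective fun x => x + t • G x := by
    intro x y hxy
    by_contra hne
    have h1 : x - y = t • G y - t • G x := by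
      have : x + t • G x = y + t • G y := hxy
      rw [sub_eq_sub_iff_add_eq_add, this, add_comm]
    have h2 := hLip.dist_le_mul y x
    rw [dist_eq_norm, ← h1, ← dist_eq_norm, dist_comm y x] at h2
    have h3 : ((‖t‖₊ * K : NNReal) : ℝ) < 1 := by exact_mod_cast ht
    nlinarith [dist_pos.2 hne]
  refine ⟨fun x hx => ?_, hinj.injOn, fun y hy => ?_⟩
  · rw [mem_ball_zero_iff] at hx ⊢
    by_contra! hge
    have h1 : (fun x => x + t • G x) (x + t • G x) = (fun x => x + t • G x) x := by
      simp [hR _ hge]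
    rw [← hinj h1] at hx
    exact absurd hx (not_lt.2 hge)
  · have hcon : ContractingWith (‖t‖₊ * K) fun x => y - t • G x :=
      ⟨ht, by simpa using (LipschitzWith.const y).sub hLip⟩
    have hfix := hcon.fixedPoint_isFixedPt
    set x := ContractingWith.fixedPoint _ hcon
    have hx : x + t • G x = y := by
      have : y - t • G x = x := hfix
      exact (sub_eq_iff_eq_add.1 this).symm
    refine ⟨x, ?_, hx⟩
    rw [mem_ball_zero_iff] at hy ⊢
    by_contra! hge
    rw [hR _ hge, smul_zero, add_zero] at hx
    rw [hx] at hge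
    exact absurd hy (not_lt.2 hge)

/-- The volume of the ball is computed by the Jacobian of a self-map of the ball which is
`C¹` up to the boundary and fixes the boundary pointwise. -/
theorem integral_det_fderiv_ball {E : Type*} [NormedAddCommGroup E] [InnerProductSpace ℝ E]
    [FiniteDimensional ℝ E] [MeasurableSpace E] [BorelSpace E] {R : ℝ} (hR : 0 < R) {r : E → E}
    (hr : ∀ x ∈ closedBall (0 : E) R, ContDiffAt ℝ 1 r x) (hfix : ∀ x, ‖x‖ = R → r x = x) :
    ∫ x in ball (0 : E) R, (fderiv ℝ r x).det = (volume : Measure E).real (ball 0 R) := by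
  obtain ⟨π, hπ1, hπC, hπid, hπ⟩ := exists_metricProjection (E := E)
    (nonempty_closedBall.2 hR.le) isClosed_closedBall.isComplete (convex_closedBall 0 R)
  have hπout : ∀ x, R ≤ ‖x‖ → ‖π x‖ = R := by
    intro x hx
    have hle : ‖π x‖ ≤ R := mem_closedBall_zero_iff.1 (hπC x)
    by_cases hxe : x = π x
    · rw [← hxe] at hle ⊢
      exact le_antisymm hle hx
    · have := mem_frontier_of_inner_le (hπC x) (sub_ne_zero.2 hxe) (hπ x)
      rw [frontier_closedBall _ hR.ne'] at this
      simpa using this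
  let g : E → E := fun x => r x - x
  have hg : ∀ x ∈ closedBall (0 : E) R, ContDiffAt ℝ 1 g x := fun x hx =>
    (hr x hx).sub contDiffAt_id
  have hcont : ContinuousOn (fderiv ℝ g) (closedBall 0 R) := fun x hx =>
    ((hg x hx).continuousAt_fderiv one_ne_zero).continuousWithinAt
  obtain ⟨K, hK⟩ := (isCompact_closedBall (0 : E) R).exists_bound_of_continuousOn hcont
  have hdiff : ∀ x ∈ closedBall (0 : E) R, DifferentiableAt ℝ g x := fun x hx =>
    (hg x hx).differentiableAt one_ne_zero
  have hLipOn : LipschitzOnWith K.toNNReal g (closedBall 0 R) :=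
    (convex_closedBall 0 R).lipschitzOnWith_of_nnnorm_fderiv_le hdiff
      fun x hx => by
        rw [← NNReal.coe_le_coe, coe_nnnorm]
        exact (hK x hx).trans (Real.le_coe_toNNReal K)
  -- `g ∘ π` extends `g` by zero outside the ball, since `g` vanishes on the sphere.
  have hLip : LipschitzWith K.toNNReal (g ∘ π) := by
    have := hLipOn.comp (hπ1.lipschitzOnWith (s := univ)) fun x _ => hπC x
    rwa [mul_one, lipschitzOnWith_univ] at this
  have hzero : ∀ x, R ≤ ‖x‖ → (g ∘ π) x = 0 := fun x hx => by
    simp [g, hfix _ (hπout x hx)]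
  have hdetcont : ∀ t : ℝ, ContinuousOn (fun x => (1 + t • fderiv ℝ g x).det) (closedBall 0 R) :=
    fun t => ContinuousLinearMap.continuous_det.comp_continuousOn
      (continuousOn_const.add (hcont.const_smul t))
  have hint : ∀ t : ℝ, IntegrableOn (fun x => (1 + t • fderiv ℝ g x).det) (ball 0 R) volume :=
    fun t => ((hdetcont t).integrableOn_compact (isCompact_closedBall _ _)).mono_set
      ball_subset_closedBall
  -- For small `t` the map `id + t g` is a bijection of the ball with positive Jacobian.
  obtain ⟨ε, hε, hdetpos⟩ : ∃ ε > 0, ∀ B : E →L[ℝ] E, ‖B‖ < ε → 0 < (1 + B).det := by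
    have h1 : ∀ᶠ B in 𝓝 (0 : E →L[ℝ] E), 0 < (1 + B).det := by
      have hc : Continuous fun B : E →L[ℝ] E => (1 + B).det :=
        ContinuousLinearMap.continuous_det.comp (continuous_const.add continuous_id)
      refine (hc.tendsto 0).eventually_const_lt ?_
      simp [ContinuousLinearMap.det]
    obtain ⟨ε, hε, h⟩ := Metric.eventually_nhds_iff.1 h1
    exact ⟨ε, hε, fun B hB => h (by simpa using hB)⟩
  have hKpos : (0 : ℝ) ≤ K := (norm_nonneg _).trans (hK 0 (mem_closedBall_self hR.le))
  have hsmall : ∀ t : ℝ, 0 ≤ t → t * K < 1 → t * K < ε →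
      ∫ x in ball (0 : E) R, (1 + t • fderiv ℝ g x).det = (volume : Measure E).real (ball 0 R) := by
    intro t ht0 ht1 htε
    have hbij := bijOn_ball_add_smul hLip hzero (t := t) (by
      rw [← NNReal.coe_lt_coe, NNReal.coe_mul, coe_nnnorm, Real.norm_of_nonneg ht0,
        Real.coe_toNNReal _ hKpos]
      exact_mod_cast ht1)
    have hbij' : BijOn (fun x => x + t • g x) (ball 0 R) (ball 0 R) :=
      hbij.congr fun x hx => by simp [hπid x (ball_subset_closedBall hx)]
    have hder : ∀ x ∈ ball (0 : E) R,
        HasFDerivWithinAt (fun x => x + t • g x) (1 + t • fderiv ℝ g x) (ball 0 R) x :=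
      fun x hx => ((hasFDerivAt_id x).add
        ((hdiff x (ball_subset_closedBall hx)).hasFDerivAt.const_smul t)).hasFDerivWithinAt
    have h := integral_image_eq_integral_abs_det_fderiv_smul volume measurableSet_ball hder
      hbij'.injOn fun _ => (1 : ℝ)
    rw [hbij'.image_eq, setIntegral_const, smul_eq_mul, mul_one] at h
    rw [h]
    refine setIntegral_congr_fun measurableSet_ball fun x hx => ?_
    have : 0 < (1 + t • fderiv ℝ g x).det := hdetpos _ <| by
      rw [norm_smul, Real.norm_of_nonneg ht0]
      exact (mul_le_mul_of_nonneg_left (hK x (ball_subset_closedBall hx)) ht0).trans_lt htε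
    simp only [smul_eq_mul, mul_one, abs_of_pos this]
  -- Interpolation at small nodes transports the identity to `t = 1`.
  let c : ℝ := min 1 ε / (2 * (K + 1) * (Module.finrank ℝ E + 1))
  have hc : 0 < c := by positivity
  let v : Fin (Module.finrank ℝ E + 1) → ℝ := fun i => c * i
  have hv : Function.Injective v := fun i j hij => by
    have := mul_left_cancel₀ hc.ne' hij
    exact Fin.ext (by exact_mod_cast this)
  have hvK : ∀ i, v i * K < min 1 ε := by
    intro i
    have hi : (i : ℝ) < Module.finrank ℝ E + 1 := by exact_mod_cast i.2
    have h0 : 0 < min 1 ε := lt_min one_pos hε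
    have h1 : c * (2 * (K + 1) * (Module.finrank ℝ E + 1)) = min 1 ε :=
      div_mul_cancel₀ _ (by positivity)
    have h2 : v i * K ≤ c * (K * (Module.finrank ℝ E + 1)) := by
      have : v i * K = c * (K * i) := by simp only [v]; ring
      rw [this]
      gcongr
    have h3 : c * (K * (Module.finrank ℝ E + 1)) <
        c * (2 * (K + 1) * (Module.finrank ℝ E + 1)) := by
      gcongr
      linarith
    linarith
  obtain ⟨w, hw1, hw⟩ := exists_weights_det E hv
  have hrg : ∀ x ∈ ball (0 : E) R, (fderiv ℝ r x).det =
      ∑ i, w i * (1 + v i • fderiv ℝ g x).det := fun x hx => by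
    rw [← hw]
    have hrd := (hr x (ball_subset_closedBall hx)).differentiableAt one_ne_zero
    have h : fderiv ℝ g x = fderiv ℝ r x - 1 := (hrd.hasFDerivAt.sub (hasFDerivAt_id x)).fderiv
    rw [h, add_sub_cancel]
  rw [setIntegral_congr_fun measurableSet_ball hrg,
    integral_finsetSum _ fun i _ => (hint (v i)).const_mul (w i)]
  simp_rw [integral_const_mul]
  rw [Finset.sum_congr rfl fun i _ => by
    rw [hsmall (v i) (by positivity) ((hvK i).trans_le (min_le_left _ _))
      ((hvK i).trans_le (min_le_right _ _))], ← Finset.sum_mul, hw1, one_mul]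

/-- There is no `C¹` retraction of a closed ball of positive radius onto its sphere: the Jacobian of
a retraction vanishes, whereas its integral is the volume of the ball. -/
theorem not_exists_contDiffAt_retraction {E : Type*} [NormedAddCommGroup E] [InnerProductSpace ℝ E]
    [FiniteDimensional ℝ E] {R : ℝ} (hR : 0 < R) {r : E → E}
    (hr : ∀ x ∈ closedBall (0 : E) R, ContDiffAt ℝ 1 r x) (hfix : ∀ x, ‖x‖ = R → r x = x)
    (hsphere : ∀ x ∈ closedBall (0 : E) R, ‖r x‖ = R) : False := by
  borelize E
  have h := integral_det_fderiv_ball hR hr hfix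
  have hdet : ∀ x ∈ ball (0 : E) R, (fderiv ℝ r x).det = 0 := by
    intro x hx
    have hd := (hr x (ball_subset_closedBall hx)).differentiableAt one_ne_zero
    -- Differentiating `‖r‖² = R²` shows that the derivative takes values orthogonal to `r x`.
    have horth : ∀ u, inner ℝ (r x) (fderiv ℝ r x u) = 0 := by
      intro u
      have h1 := hd.hasFDerivAt.norm_sq
      have h2 : (fun y => ‖r y‖ ^ 2) =ᶠ[𝓝 x] fun _ => R ^ 2 := by
        filter_upwards [isOpen_ball.mem_nhds hx] with y hy
        rw [hsphere y (ball_subset_closedBall hy)]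
      have h3 := h1.unique ((hasFDerivAt_const (R ^ 2) x).congr_of_eventuallyEq h2)
      have h4 := congrArg (fun φ => φ u) h3
      simpa using h4
    by_contra hne
    have hsurj : Function.Surjective (fderiv ℝ r x : E →ₗ[ℝ] E) :=
      ((Module.End.isUnit_iff _).1
        ((LinearMap.isUnit_iff_isUnit_det _).2 (isUnit_iff_ne_zero.2 hne))).surjective
    obtain ⟨u, hu⟩ := hsurj (r x)
    have h5 := horth u
    have hu' : fderiv ℝ r x u = r x := hu
    rw [hu', inner_self_eq_zero] at h5
    have h6 := hsphere x (ball_subset_closedBall hx)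
    rw [h5, norm_zero] at h6
    exact hR.ne h6
  rw [setIntegral_congr_fun measurableSet_ball hdet] at h
  have hpos : 0 < (volume : Measure E).real (ball 0 R) :=
    ENNReal.toReal_pos (measure_ball_pos volume 0 hR).ne' measure_ball_lt_top.ne
  simp at h
  linarith

/-! ### Brouwer's fixed point theorem and variational inequalities -/

/-- **Brouwer's fixed point theorem** for a `C¹` map into an open ball. -/
theorem exists_fixedPoint_of_contDiff {E : Type*} [NormedAddCommGroup E] [InnerProductSpace ℝ E]
    [FiniteDimensional ℝ E] {g : E → E} (hg : ContDiff ℝ 1 g) {R : ℝ} (hR : ∀ x, ‖g x‖ < R) :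
    ∃ x, g x = x := by
  by_contra! hne
  have hR0 : 0 < R := (norm_nonneg _).trans_lt (hR 0)
  -- `x + s x • u x` is the point where the ray from `g x` through `x` leaves the ball.
  let u : E → E := fun x => x - g x
  let D : E → ℝ := fun x => inner ℝ x (u x) ^ 2 + ‖u x‖ ^ 2 * (R ^ 2 - ‖x‖ ^ 2)
  let s : E → ℝ := fun x => (√(D x) - inner ℝ x (u x)) / ‖u x‖ ^ 2
  have hu : ∀ x, 0 < ‖u x‖ := fun x => norm_pos_iff.2 (sub_ne_zero.2 (hne x).symm)
  have hinner : ∀ x, ‖x‖ = R → 0 < inner ℝ x (u x) := by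
    intro x hx
    have h1 := real_inner_le_norm x (g x)
    simp only [u, inner_sub_right, real_inner_self_eq_norm_mul_norm, hx] at h1 ⊢
    nlinarith [hR x]
  have hD : ∀ x ∈ closedBall (0 : E) R, 0 < D x := by
    intro x hx
    rw [mem_closedBall_zero_iff] at hx
    have hux := hu x
    rcases hx.lt_or_eq with hlt | heq
    · have : 0 < R ^ 2 - ‖x‖ ^ 2 := by nlinarith [norm_nonneg x]
      positivity
    · have := hinner x heq
      have h0 : R ^ 2 - ‖x‖ ^ 2 = 0 := by rw [heq, sub_self]
      simp only [D, h0, mul_zero, add_zero]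
      positivity
  have hucd : ContDiff ℝ 1 u := contDiff_id.sub hg
  have hin : ContDiff ℝ 1 fun x => inner ℝ x (u x) := contDiff_id.inner ℝ hucd
  have hDcd : ContDiff ℝ 1 D := (hin.pow 2).add ((hucd.norm_sq ℝ).mul
    (contDiff_const.sub (contDiff_id.norm_sq ℝ)))
  refine not_exists_contDiffAt_retraction hR0 (r := fun x => x + s x • u x) ?_ ?_ ?_
  · intro x hx
    have hs : ContDiffAt ℝ 1 s x := ((hDcd.contDiffAt.sqrt (hD x hx).ne').sub hin.contDiffAt).div
      (hucd.norm_sq ℝ).contDiffAt (pow_pos (hu x) 2).ne'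
    exact contDiffAt_id.add (hs.smul hucd.contDiffAt)
  · intro x hx
    have h0 : s x = 0 := by
      simp only [s, D, hx, sub_self, mul_zero, add_zero, Real.sqrt_sq (hinner x hx).le, zero_div]
    simp [h0]
  · intro x hx
    have h1 : s x * ‖u x‖ ^ 2 = √(D x) - inner ℝ x (u x) :=
      div_mul_cancel₀ _ (pow_pos (hu x) 2).ne'
    have h2 : √(D x) ^ 2 = D x := Real.sq_sqrt (hD x hx).le
    have h3 : ‖x + s x • u x‖ ^ 2 = R ^ 2 := by
      rw [norm_add_sq_real, real_inner_smul_right, norm_smul, mul_pow, Real.norm_eq_abs, sq_abs]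
      have h4 : (√(D x)) ^ 2 = (s x * ‖u x‖ ^ 2 + inner ℝ x (u x)) ^ 2 := by rw [h1]; ring
      have h5 : ‖u x‖ ^ 2 * (‖x‖ ^ 2 + 2 * (s x * inner ℝ x (u x)) + s x ^ 2 * ‖u x‖ ^ 2) =
          ‖u x‖ ^ 2 * R ^ 2 := by
        rw [h2] at h4
        simp only [D] at h4
        linarith
      exact mul_left_cancel₀ (pow_pos (hu x) 2).ne' h5
    exact (sq_eq_sq₀ (norm_nonneg _) hR0.le).1 h3

/-- **Brouwer's fixed point theorem** for a bounded continuous self-map of a finite-dimensional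
space. -/
theorem exists_fixedPoint_of_bounded {E : Type*} [NormedAddCommGroup E] [InnerProductSpace ℝ E]
    [FiniteDimensional ℝ E] {T : E → E} (hT : Continuous T) {R : ℝ} (hR : ∀ x, ‖T x‖ ≤ R) :
    ∃ x, T x = x := by
  by_contra! hne
  have hR0 : 0 ≤ R := (norm_nonneg _).trans (hR 0)
  have hcont : Continuous fun x => dist (T x) x := hT.dist continuous_id
  obtain ⟨x₀, -, hx₀⟩ := (isCompact_closedBall (0 : E) (R + 1)).exists_isMinOn
    (nonempty_closedBall.2 (by linarith)) hcont.continuousOn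
  have hδ : 0 < min 1 (dist (T x₀) x₀) := lt_min one_pos (dist_pos.2 (hne x₀))
  obtain ⟨g, hg, hgT, -⟩ := hT.exists_contDiff_approx 1
    (ε := fun _ => min 1 (dist (T x₀) x₀)) continuous_const fun _ => hδ
  have hgR : ∀ x, ‖g x‖ < R + 1 := by
    intro x
    have h1 := (hgT x).trans_le (min_le_left _ _)
    rw [dist_eq_norm] at h1
    linarith [norm_le_insert' (g x) (T x), hR x]
  obtain ⟨x, hx⟩ := exists_fixedPoint_of_contDiff (by exact_mod_cast hg) hgR
  have hxR : x ∈ closedBall (0 : E) (R + 1) := by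
    rw [mem_closedBall_zero_iff, ← hx]
    exact (hgR x).le
  have h1 : dist (T x₀) x₀ ≤ dist (T x) x := hx₀ hxR
  have h2 := (hgT x).trans_le (min_le_right _ _)
  rw [hx, dist_comm] at h2
  exact absurd h1 (not_le.2 h2)

/-- A continuous vector field on a finite-dimensional space has, on any nonempty compact convex set,
a point at which it is normal to the set and directed exteriorly (or zero). -/
theorem exists_inner_le_of_finiteDimensional {E : Type*} [NormedAddCommGroup E]
    [InnerProductSpace ℝ E] [FiniteDimensional ℝ E] {C : Set E} (hne : C.Nonempty)
    (hC : IsCompact C) (hconv : Convex ℝ C) {S : E → E} (hS : Continuous S) :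
    ∃ f ∈ C, ∀ g ∈ C, inner ℝ (S f) (g - f) ≤ 0 := by
  obtain ⟨π, hπ1, hπC, hπid, hπ⟩ := exists_metricProjection hne hC.isComplete hconv
  obtain ⟨R, hR⟩ := hC.isBounded.exists_norm_le
  obtain ⟨f, hf⟩ := exists_fixedPoint_of_bounded (T := fun x => π (x + S x))
    (hπ1.continuous.comp (continuous_id.add hS)) fun x => hR _ (hπC _)
  refine ⟨f, hf ▸ hπC _, fun g hg => ?_⟩
  have h := hπ (f + S f) g hg
  have hf' : π (f + S f) = f := hf
  rwa [hf', add_sub_cancel_left] at h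

/-- A continuous vector field on an inner product space has, on any nonempty compact convex set,
a point at which it is normal to the set and directed exteriorly (or zero). By compactness it is
enough to test against finitely many points of the set, and these span a finite-dimensional
subspace. -/
theorem exists_inner_le_of_isCompact {E : Type*} [NormedAddCommGroup E] [InnerProductSpace ℝ E]
    {C : Set E} (hne : C.Nonempty) (hC : IsCompact C) (hconv : Convex ℝ C) {S : E → E}
    (hS : Continuous S) : ∃ f ∈ C, ∀ g ∈ C, inner ℝ (S f) (g - f) ≤ 0 := by
  obtain ⟨c, hc⟩ := hne
  suffices h : ∀ t : Finset C, (C ∩ ⋂ g ∈ t, {f | inner ℝ (S f) ((g : E) - f) ≤ 0}).Nonempty by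
    obtain ⟨f, hfC, hf⟩ := hC.inter_iInter_nonempty
      (fun g : C => {f | inner ℝ (S f) ((g : E) - f) ≤ 0})
      (fun g => isClosed_le (hS.inner (continuous_const.sub continuous_id)) continuous_const) h
    exact ⟨f, hfC, fun g hg => mem_iInter.1 hf ⟨g, hg⟩⟩
  intro t
  let A : Set E := insert c ((↑) '' (t : Set C))
  have hAC : A ⊆ C := insert_subset hc (by rintro _ ⟨g, -, rfl⟩; exact g.2)
  have hAfin : A.Finite := (t.finite_toSet.image _).insert c
  let W := Submodule.span ℝ A
  have : FiniteDimensional ℝ W := FiniteDimensional.span_of_finite ℝ hAfin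
  have hWc : IsClosed (W : Set E) := W.closed_of_finiteDimensional
  have hAW : convexHull ℝ A ⊆ W := convexHull_min Submodule.subset_span W.convex
  have hcA : c ∈ convexHull ℝ A := subset_convexHull ℝ A (mem_insert _ _)
  obtain ⟨f, hf, hfle⟩ := exists_inner_le_of_finiteDimensional (C := (W.subtype ⁻¹' convexHull ℝ A))
    ⟨⟨c, hAW hcA⟩, hcA⟩
    (hWc.isClosedEmbedding_subtypeVal.isCompact_preimage (hAfin.isCompact_convexHull ℝ))
    ((convex_convexHull ℝ A).linear_preimage _)
    (S := fun w => W.orthogonalProjectionOnto (S w))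
    (W.orthogonalProjectionOnto.continuous.comp (hS.comp continuous_subtype_val))
  refine ⟨f, convexHull_min hAC hconv hf, mem_iInter₂.2 fun g hg => ?_⟩
  have hgA : (g : E) ∈ convexHull ℝ A := subset_convexHull ℝ A (mem_insert_of_mem _ ⟨g, hg, rfl⟩)
  have h := hfle ⟨g, hAW hgA⟩ hgA
  rwa [Submodule.inner_orthogonalProjectionOnto_eq_of_mem_right] at h

/-! ### The forecasting game -/

section Game

variable {X L H : Type*} [NormedAddCommGroup L] [InnerProductSpace ℝ L]
  [NormedAddCommGroup H] [InnerProductSpace ℝ H] {Y : Set L}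

theorem isCompact_forecasts [CompleteSpace L] (hYc : IsCompact (closure Y)) :
    IsCompact (Forecasts Y : Set L) := by
  have hE : Forecasts Y = closure (convexHull ℝ Y) := closedConvexHull_eq_closure_convexHull
  rw [hE]
  exact isCompact_iff_totallyBounded_isComplete.2
    ⟨(hYc.totallyBounded.subset subset_closure).convexHull.closure, isClosed_closure.isComplete⟩

theorem continuous_field {K : Forecasts Y × X → Forecasts Y × X → ℝ}
    (hK : ∀ z x, Continuous fun f : Forecasts Y => K z (f, x)) (past : List (Round X Y)) (x : X) :
    Continuous (field K past x) :=
  continuous_list_sum _ fun r _ => (hK (r.forecast, r.datum) x).smul continuous_const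

theorem exists_isK29Choice [CompleteSpace L] (hY : Y.Nonempty) (hYc : IsCompact (closure Y))
    {S : Forecasts Y → L} (hS : Continuous S) : ∃ f, IsK29Choice S f := by
  have hF := isCompact_forecasts hYc
  have hne : (Forecasts Y : Set L).Nonempty := hY.mono subset_closedConvexHull
  have hconv : Convex ℝ (Forecasts Y : Set L) := convex_closedConvexHull
  obtain ⟨π, hπ1, hπF, hπid, -⟩ := exists_metricProjection hne hF.isComplete hconv
  -- Composing with the projection extends `S` continuously to the whole space.
  obtain ⟨f, hf, hle⟩ := exists_inner_le_of_isCompact hne hF hconv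
    (S := fun l => S ⟨π l, hπF l⟩) (hS.comp (hπ1.continuous.subtype_mk _))
  have hπf : (⟨π f, hπF f⟩ : Forecasts Y) = ⟨f, hf⟩ := Subtype.ext (hπid f hf)
  simp only [hπf] at hle
  by_cases h0 : ∃ g, S g = 0
  · obtain ⟨g, hg⟩ := h0
    exact ⟨g, Or.inl hg⟩
  · exact ⟨⟨f, hf⟩, Or.inr ⟨h0, mem_frontier_of_inner_le hf (fun h => h0 ⟨_, h⟩) hle,
      fun g => hle g g.2⟩⟩

/-- Observations and forecasts are at most `diam Y` apart, since a closed ball of that radius around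
an observation is closed and convex and contains `Y`. -/
theorem norm_obs_sub_forecast_le (hYb : Bornology.IsBounded Y) (y : Y) (f : Forecasts Y) :
    ‖(y : L) - f‖ ≤ diam Y := by
  have h : Forecasts Y ⊆ closedBall (y : L) (diam Y) :=
    closedConvexHull_min (fun z hz => dist_le_diam_of_mem hYb hz y.2) (convex_closedBall _ _)
      isClosed_closedBall
  rw [← dist_eq_norm, dist_comm]
  exact h f.2

theorem inner_tmul_tmul (l l' : L) (h h' : H) :
    inner ℝ (tmul l h) (tmul l' h') = inner ℝ l l' * inner ℝ h h' := by
  simp [tmul]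

theorem norm_tmul_eq (l : L) (h : H) : ‖tmul l h‖ = ‖l‖ * ‖h‖ := by
  simp [tmul]

theorem IsK29Choice.inner_le {S : Forecasts Y → L} {f : Forecasts Y} (h : IsK29Choice S f)
    (g : Forecasts Y) : inner ℝ (S f) ((g : L) - f) ≤ 0 := by
  rcases h with h | ⟨-, -, h⟩
  · rw [h, inner_zero_left]
  · exact h g

theorem field_history (K : Forecasts Y × X → Forecasts Y × X → ℝ) (σ : Strategy X Y) (x : ℕ → X)
    (y : ℕ → Y) (n : ℕ) (x' : X) (f : Forecasts Y) :
    field K (history σ x y n) x' f = ∑ i ∈ Finset.range n,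
      K (forecastAt σ x y i, x i) (f, x') • ((y i : L) - (forecastAt σ x y i : L)) := by
  induction n with
  | zero => simp [field, history]
  | succ n ih =>
    rw [Finset.sum_range_succ, ← ih]
    simp [field, history, forecastAt]

/-- The cumulative error `∑ (yᵢ - fᵢ) ⊗ Φ(fᵢ, xᵢ)` makes an obtuse angle with the next term, because
their inner product is `⟪S(fₙ), yₙ - fₙ⟫`. -/
theorem inner_sum_tmul_le {Φ : Forecasts Y × X → H} {σ : Strategy X Y} (hσ : IsK29 (kernel Φ) σ)
    (x : ℕ → X) (y : ℕ → Y) (n : ℕ) :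
    inner ℝ (∑ i ∈ Finset.range n, tmul ((y i : L) - (forecastAt σ x y i : L))
        (Φ (forecastAt σ x y i, x i)))
      (tmul ((y n : L) - (forecastAt σ x y n : L)) (Φ (forecastAt σ x y n, x n))) ≤ 0 := by
  have h := (hσ (history σ x y n) (x n)).inner_le ⟨y n, subset_closedConvexHull (y n).2⟩
  change inner ℝ (field _ _ _ (forecastAt σ x y n)) ((y n : L) - (forecastAt σ x y n : L)) ≤ 0 at h
  rw [field_history, sum_inner] at h
  rw [sum_inner]
  refine (Finset.sum_congr rfl fun i _ => ?_).trans_le h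
  rw [inner_tmul_tmul, real_inner_smul_left, mul_comm, kernel]

theorem norm_sum_tmul_le {Φ : Forecasts Y × X → H} {σ : Strategy X Y} (hσ : IsK29 (kernel Φ) σ)
    (hYb : Bornology.IsBounded Y) (hΦ : BddAbove (Set.range fun z => ‖Φ z‖))
    (x : ℕ → X) (y : ℕ → Y) (n : ℕ) :
    ‖∑ i ∈ Finset.range n, tmul ((y i : L) - (forecastAt σ x y i : L))
        (Φ (forecastAt σ x y i, x i))‖ ≤ diam Y * (⨆ z, ‖Φ z‖) * √(n : ℝ) := by
  have hC : 0 ≤ diam Y * ⨆ z, ‖Φ z‖ :=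
    mul_nonneg diam_nonneg (Real.iSup_nonneg fun z => norm_nonneg _)
  have hsq : ∀ n : ℕ, ‖∑ i ∈ Finset.range n, tmul ((y i : L) - (forecastAt σ x y i : L))
      (Φ (forecastAt σ x y i, x i))‖ ^ 2 ≤ (diam Y * ⨆ z, ‖Φ z‖) ^ 2 * n := by
    intro n
    induction n with
    | zero => simp
    | succ n ih =>
      rw [Finset.sum_range_succ, norm_add_sq_real]
      have h1 := inner_sum_tmul_le hσ x y n
      have h2 : ‖tmul ((y n : L) - (forecastAt σ x y n : L)) (Φ (forecastAt σ x y n, x n))‖ ≤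
          diam Y * ⨆ z, ‖Φ z‖ := by
        rw [norm_tmul_eq]
        exact mul_le_mul (norm_obs_sub_forecast_le hYb _ _) (le_ciSup hΦ _) (norm_nonneg _)
          diam_nonneg
      have h3 := pow_le_pow_left₀ (norm_nonneg _) h2 2
      push_cast
      linarith
  refine (sq_le_sq₀ (norm_nonneg _) (mul_nonneg hC (Real.sqrt_nonneg _))).1 ?_
  rw [mul_pow, Real.sq_sqrt n.cast_nonneg]
  exact hsq n

end Game

end K29

theorem theorem3 {X L H : Type*}
    [NormedAddCommGroup L] [InnerProductSpace ℝ L] [CompleteSpace L]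
    [NormedAddCommGroup H] [InnerProductSpace ℝ H] [CompleteSpace H]
    (Y : Set L) (hY : Y.Nonempty) (hYc : IsCompact (closure Y))
    (Φ : K29.Forecasts Y × X → H) (hK : K29.Admissible (K29.kernel Φ)) :
    (∃ σ : K29.Strategy X Y, K29.IsK29 (K29.kernel Φ) σ) ∧
      (BddAbove (Set.range fun z => ‖Φ z‖) →
        ∀ σ : K29.Strategy X Y, K29.IsK29 (K29.kernel Φ) σ →
          ∀ (x : ℕ → X) (y : ℕ → Y) (n : ℕ),
            ‖∑ i ∈ Finset.range n,
                K29.tmul ((y i : L) - (K29.forecastAt σ x y i : L))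
                  (Φ (K29.forecastAt σ x y i, x i))‖
              ≤ Metric.diam Y * (⨆ z, ‖Φ z‖) * √(n : ℝ)) := by
  have hK' : ∀ z x, Continuous fun f : K29.Forecasts Y => K29.kernel Φ z (f, x) := by
    intro z x
    have h := hK x z
    simp only [K29.kernel] at h ⊢
    simpa only [real_inner_comm] using h
  refine ⟨?_, fun hΦ σ hσ x y n =>
    K29.norm_sum_tmul_le hσ (hYc.isBounded.subset subset_closure) hΦ x y n⟩
  choose σ hσ using fun (past : List (K29.Round X Y)) (x : X) =>
    K29.exists_isK29Choice hY hYc (K29.continuous_field hK' past x)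
  exact ⟨σ, hσ⟩
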